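/- Let $p\ge 1$, let $\hat\Sigma\in\mathbb{R}^{p\times p}$ be a symmetric positive semi-definite matrix (for instance the sample covariance matrix of $n$ observations in $\mathbb{R}^p$) whose diagonal entries are all strictly positive, and let $\lambda>0$. For $\Omega=(\omega_{ij})$ in the set $\mathcal{X}$ of symmetric real $p\times p$ matrices with non-negative diagonal entries, with columns $\Omega_{\cdot i}$, put $$Q_{con}(\Omega)=-\sum_{i=1}^p\log\omega_{ii}+\frac12\sum_{i=1}^p\Omega_{\cdot i}^T\hat\Sigma\,\Omega_{\cdot i}+\lambda\sum_{1\le i<j\le p}|\omega_{ij}|\in(-\infty,+\infty],$$ where $-\log 0=+\infty$. Fix any ordering $c_1,\dots,c_N$, $N=p(p+1)/2$, of the coordinates $(k,l)$, $1\le k\le l\le p$, and any starting point $\Omega^0\in\mathcal{X}$ with $Q_{con}(\Omega^0)<\infty$. The cyclic coordinatewise minimization (CONCORD) algorithm sets, for $r=0,1,2,\dots$, $\Omega^{r,0}=\Omega^r$; for $i=1,\dots,N$, with $c_i=(k,l)$, $$\Omega^{r,i}=\operatorname{arg\,min}\{Q_{con}(\Omega):\ \Omega\in\mathcal{X},\ \Omega\text{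 agrees with }\Omega^{r,i-1}\text{ in all entries except possibly }(k,l)\text{ and }(l,k)\};$$ and $\Omega^{r+1}=\Omega^{r,N}$. Then each of these minimizers exists and is unique, so that the algorithm is well defined, and the sequence of iterates $(\Omega^r)_{r\ge 0}$ converges to some $\Omega^*\in\mathcal{X}$ with $Q_{con}(\Omega^*)\le Q_{con}(\Omega)$ for every $\Omega\in\mathcal{X}$. -/

import Mathlib

open scoped Matrix

noncomputable section

namespace Concord

/-- The extended-real convex function `x ↦ -log x`, equal to `+∞` when `x ≤ 0`. -/
def negLog (x : ℝ) : EReal :=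
  if 0 < x then ((-Real.log x : ℝ) : EReal) else ⊤

/-- The finite part of the objective: half the sum over the columns `Ω_{·i}` of
`Ω_{·i}ᵀ S Ω_{·i}`, plus `lam` times the sum of `|ω_ij|` over `i < j`. -/
def quadL1 {p : ℕ} (S : Matrix (Fin p) (Fin p) ℝ) (lam : ℝ) (Ω : Matrix (Fin p) (Fin p) ℝ) : ℝ :=
  (1 / 2 : ℝ) * ∑ i, Ω.col i ⬝ᵥ (S *ᵥ Ω.col i) + lam * ∑ i, ∑ j ∈ Finset.Ioi i, |Ω i j|

/-- The objective function `Q_con`, with values in `(-∞, +∞]`. -/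
def Qcon {p : ℕ} (S : Matrix (Fin p) (Fin p) ℝ) (lam : ℝ) (Ω : Matrix (Fin p) (Fin p) ℝ) : EReal :=
  ∑ i, negLog (Ω i i) + (quadL1 S lam Ω : EReal)

/-- The constraint set: symmetric matrices with non-negative diagonal entries. -/
def feasible (p : ℕ) : Set (Matrix (Fin p) (Fin p) ℝ) :=
  {Ω | Ω.IsSymm ∧ ∀ i, 0 ≤ Ω i i}

/-- The free coordinates of a symmetric `p × p` matrix: the positions `(k, l)` with `k ≤ l`. -/
abbrev Coord (p : ℕ) : Type := {q : Fin p × Fin p // q.1 ≤ q.2}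

/-- The feasible matrices that agree with `Ω` in every coordinate except possibly `c = (k, l)`,
that is, in every entry outside the positions `(k, l)` and `(l, k)`. -/
def coordSlice {p : ℕ} (c : Coord p) (Ω : Matrix (Fin p) (Fin p) ℝ) :
    Set (Matrix (Fin p) (Fin p) ℝ) :=
  {Ω' | Ω' ∈ feasible p ∧
    ∀ i j, (i, j) ≠ c.1 → (j, i) ≠ c.1 → Ω' i j = Ω i j}

/-- `Ω'` is obtained from `Ω` by minimizing `Q_con` over the coordinate `c` alone. -/
def IsCoordMin {p : ℕ} (S : Matrix (Fin p) (Fin p) ℝ) (lam : ℝ) (c : Coord p)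
    (Ω Ω' : Matrix (Fin p) (Fin p) ℝ) : Prop :=
  Ω' ∈ coordSlice c Ω ∧ IsMinOn (Qcon S lam) (coordSlice c Ω) Ω'

/-- `Z` is a run of cyclic coordinatewise minimization for `Q_con` from `Ω₀`, updating the
coordinates in the order `e 0, e 1, …, e (N - 1)` in each sweep. `Z r 0` is the `r`-th iterate,
and `Z r i` is the state of the `r`-th sweep after its first `i` coordinate updates. -/
structure IsCCMRun {p N : ℕ} (S : Matrix (Fin p) (Fin p) ℝ) (lam : ℝ) (e : Fin N ≃ Coord p)
    (Ω₀ : Matrix (Fin p) (Fin p) ℝ) (Z : ℕ → Fin (N + 1) → Matrix (Fin p) (Fin p) ℝ) : Prop where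
  init : Z 0 0 = Ω₀
  step : ∀ (r : ℕ) (i : Fin N), IsCoordMin S lam (e i) (Z r i.castSucc) (Z r i.succ)
  next : ∀ r : ℕ, Z (r + 1) 0 = Z r (Fin.last N)

end Concord

end

/-! In the free coordinates of a symmetric matrix the objective is a positive semi-definite
quadratic form plus separable convex terms, `-log` on the diagonal and `lam * |·|` off it. The form
may be singular and minimizers need not be unique, so monotone descent alone does not make the
iterates converge. The proof obtains a linear rate from an error bound.

Three estimates combine. Positive diagonal entries make every coordinate problem strongly convex, so
a sweep of length `s` lowers the objective by `D ≥ c * s ^ 2` (`exists_sufficient_decrease`). The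
optimality conditions of the updates give suboptimality `δ ≤ L * s * d` after the sweep, `d` being
the distance to any chosen minimizer (`exists_suboptimality_bound`). On bounded sets a minimizer can
be chosen with `a * d ^ 2 ≤ δ` (`exists_quadratic_growth`). Together `δ ≤ C * D`: suboptimality
decays geometrically, hence so do the sweep lengths, and the iterates are Cauchy.

Quadratic growth is the main point. Around a minimizer `xs` the excess is half the form plus
nonnegative one-variable functions. Each coordinate is first moved to a zero of its function. From
the resulting displacement a null vector of the form is split off that lies coordinatewise between
zero and the displacement: adding it to `xs` gives another minimizer, and the form controls what is
left. -/

namespace Concord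

/-! ### Error bound for semi-definite forms via sign cones -/

section Cone

variable {J : Type*} [Fintype J]

/-- A continuous function, homogeneous of degree two and positive on a closed cone away from the
origin, dominates a multiple of the squared norm on that cone. -/
lemma exists_mul_sq_norm_le_of_pos_on_cone {K : Set (J → ℝ)} (hK : IsClosed K)
    (hcone : ∀ u ∈ K, ∀ t : ℝ, 0 < t → t • u ∈ K) {f : (J → ℝ) → ℝ} (hf : Continuous f)
    (hom : ∀ (t : ℝ) (u : J → ℝ), f (t • u) = t ^ 2 * f u)
    (hpos : ∀ u ∈ K, u ≠ 0 → 0 < f u) :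
    ∃ c : ℝ, 0 < c ∧ ∀ u ∈ K, c * ‖u‖ ^ 2 ≤ f u := by
  have hzero : f 0 = 0 := by simpa using hom 0 0
  have hcomp : IsCompact (Metric.sphere (0 : J → ℝ) 1 ∩ K) := (isCompact_sphere 0 1).inter_right hK
  have hscale : ∀ u ∈ K, u ≠ 0 → (‖u‖⁻¹ • u) ∈ Metric.sphere (0 : J → ℝ) 1 ∩ K := by
    intro u hu hne
    refine ⟨?_, hcone u hu _ (by positivity)⟩
    rw [mem_sphere_zero_iff_norm, norm_smul, norm_inv, norm_norm,
      inv_mul_cancel₀ (norm_ne_zero_iff.2 hne)]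
  rcases (Metric.sphere (0 : J → ℝ) 1 ∩ K).eq_empty_or_nonempty with he | hn
  · refine ⟨1, one_pos, fun u hu => ?_⟩
    by_cases hne : u = 0
    · simp [hne, hzero]
    · exact absurd (hscale u hu hne) (by simp [he])
  · obtain ⟨m, hm, hmin⟩ := hcomp.exists_isMinOn hn hf.continuousOn
    have hm0 : m ≠ 0 := by
      rintro rfl
      simpa using hm.1
    refine ⟨f m, hpos m hm.2 hm0, fun u hu => ?_⟩
    by_cases hne : u = 0
    · simp [hne, hzero]
    · have h := hmin (hscale u hu hne)
      simp only [Set.mem_ofPred_eq, hom] at h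
      have hp : 0 < ‖u‖ := norm_pos_iff.2 hne
      rw [inv_pow, inv_mul_eq_div, le_div_iff₀ (by positivity)] at h
      exact h

/-- The cone of vectors whose coordinates have the signs prescribed by `s`. -/
def signCone (s : J → SignType) : Set (J → ℝ) := {k | ∀ j, (s j : ℝ) * k j = |k j|}

omit [Fintype J] in
lemma isClosed_signCone (s : J → SignType) : IsClosed (signCone s) := by
  simp only [signCone, Set.ofPred_forall]
  exact isClosed_iInter fun j => isClosed_eq (by fun_prop) (by fun_prop)

omit [Fintype J] in
lemma smul_mem_signCone {s : J → SignType} {u : J → ℝ} (hu : u ∈ signCone s) {t : ℝ}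
    (ht : 0 < t) : t • u ∈ signCone s := by
  intro j
  simp only [Pi.smul_apply, smul_eq_mul, abs_mul, abs_of_pos ht]
  rw [← hu j]
  ring

/-- Take `n` in `W` and in the box between `0` and `v` with maximal signed coordinate sum. A nonzero
`k ∈ W` with the sign pattern of `v - n` could be added in a small multiple, staying in the box and
increasing the sum. -/
lemma exists_maximal_conformal (W : Submodule ℝ (J → ℝ)) (v : J → ℝ) :
    ∃ n ∈ W, (∀ j, n j ∈ Set.uIcc 0 (v j)) ∧
      ∀ k ∈ W, k ∈ signCone (fun j => SignType.sign (v j - n j)) → k = 0 := by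
  have hWc : IsClosed (W : Set (J → ℝ)) := W.closed_of_finiteDimensional
  have hcomp : IsCompact ((Set.univ.pi fun j => Set.uIcc 0 (v j)) ∩ (W : Set (J → ℝ))) :=
    (isCompact_univ_pi fun j => isCompact_uIcc).inter_right hWc
  obtain ⟨n, ⟨hn, hnW⟩, hmax⟩ := hcomp.exists_isMaxOn
    (f := fun n => ∑ j, (SignType.sign (v j) : ℝ) * n j)
    ⟨0, fun j _ => Set.left_mem_uIcc, W.zero_mem⟩ (by fun_prop)
  replace hn : ∀ j, n j ∈ Set.uIcc 0 (v j) := fun j => hn j trivial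
  refine ⟨n, hnW, hn, fun k hkW hk => ?_⟩
  have hsign : ∀ j, k j ≠ 0 → v j - n j ≠ 0 ∧ 0 < (SignType.sign (v j) : ℝ) * k j ∧
      0 < (v j - n j) * k j := by
    intro j hj
    have h1 := hk j
    have h2 := hn j
    have h3 := abs_pos.2 hj
    rcases lt_trichotomy (v j - n j) 0 with h | h | h
    · simp only [sign_neg h, SignType.coe_neg_one] at h1
      have : v j < 0 := by
        by_contra hv
        rw [Set.uIcc_of_le (not_lt.1 hv)] at h2
        linarith [h2.1, h2.2]
      rw [sign_neg this]
      refine ⟨h.ne, by simpa using by linarith, mul_pos_of_neg_of_neg h (by linarith)⟩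
    · simp only [h, sign_zero, SignType.coe_zero, zero_mul] at h1
      exact absurd (abs_eq_zero.1 h1.symm) hj
    · simp only [sign_pos h, SignType.coe_one] at h1
      have : 0 < v j := by
        by_contra hv
        rw [Set.uIcc_of_ge (not_lt.1 hv)] at h2
        linarith [h2.1, h2.2]
      rw [sign_pos this]
      refine ⟨h.ne', by simpa using by linarith, mul_pos h (by linarith)⟩
  have hev : ∀ᶠ ε : ℝ in nhdsWithin 0 (Set.Ioi 0), ∀ j, ε * |k j| ≤ |v j - n j| := by
    rw [Filter.eventually_all]
    intro j
    by_cases hj : k j = 0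
    · simp [hj]
    · have hlim : Filter.Tendsto (fun ε : ℝ => ε * |k j|) (nhdsWithin 0 (Set.Ioi 0)) (nhds 0) := by
        have : Filter.Tendsto (fun ε : ℝ => ε * |k j|) (nhds 0) (nhds (0 * |k j|)) :=
          (continuous_id.mul continuous_const).tendsto 0
        rw [zero_mul] at this
        exact this.mono_left nhdsWithin_le_nhds
      exact (hlim.eventually_lt_const (abs_pos.2 (hsign j hj).1)).mono fun _ h => h.le
  obtain ⟨ε, hε, hεpos⟩ := (hev.and self_mem_nhdsWithin).exists
  have hεpos : 0 < ε := hεpos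
  have hmem : n + ε • k ∈ (Set.univ.pi fun j => Set.uIcc 0 (v j)) ∩ (W : Set (J → ℝ)) := by
    refine ⟨fun j _ => ?_, W.add_mem hnW (W.smul_mem _ hkW)⟩
    have h2 := hn j
    simp only [Pi.add_apply, Pi.smul_apply, smul_eq_mul]
    by_cases hj : k j = 0
    · simpa [hj] using h2
    · have h3 := hε j
      have h4 := (hsign j hj).2.2
      have h5 := (hsign j hj).1
      rw [Set.mem_uIcc] at h2 ⊢
      rcases lt_or_gt_of_ne h5 with h | h
      · have hk0 : k j < 0 := by
          by_contra hc
          nlinarith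
        rw [abs_of_neg h, abs_of_neg hk0] at h3
        rcases h2 with h2 | h2
        · linarith
        · right; constructor <;> nlinarith
      · have hk0 : 0 < k j := by
          by_contra hc
          nlinarith
        rw [abs_of_pos h, abs_of_pos hk0] at h3
        rcases h2 with h2 | h2
        · left; constructor <;> nlinarith
        · linarith
  have hle := hmax hmem
  simp only [Set.mem_ofPred_eq, Pi.add_apply, Pi.smul_apply, smul_eq_mul, mul_add,
    Finset.sum_add_distrib] at hle
  by_contra hk0
  obtain ⟨j, hj⟩ := Function.ne_iff.1 hk0
  have : 0 < ∑ j, (SignType.sign (v j) : ℝ) * (ε * k j) := by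
    refine Finset.sum_pos' (fun i _ => ?_) ⟨j, Finset.mem_univ _, ?_⟩
    · by_cases hi : k i = 0
      · simp [hi]
      · rw [mul_left_comm]
        exact (mul_pos hεpos (hsign i hi).2.1).le
    · rw [mul_left_comm]
      exact mul_pos hεpos (hsign j hj).2.1
  linarith

/-- Along `y + t • x` the form is affine in `t`, so nonnegativity forces its slope to vanish. -/
lemma form_apply_eq_zero {V : Type*} [AddCommGroup V] [Module ℝ V] {b : LinearMap.BilinForm ℝ V}
    (hsymm : ∀ x y, b x y = b y x) (hnn : ∀ x, 0 ≤ b x x) {x : V} (hx : b x x = 0) (y : V) :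
    b x y = 0 := by
  by_contra hne
  have hsq : 0 < (b x y) ^ 2 := by positivity
  have key : ∀ t : ℝ, 0 ≤ b y y + 2 * t * b x y := fun t => by
    have h := hnn (y + t • x)
    simp only [map_add, map_smul, LinearMap.add_apply, LinearMap.smul_apply, smul_eq_mul, hx,
      hsymm y x] at h
    linarith
  have h := key (-(b y y + 1) / (2 * b x y))
  have h2 : 2 * (-(b y y + 1) / (2 * b x y)) * b x y = -(b y y + 1) := by field_simp
  linarith

lemma continuous_form_self (b : LinearMap.BilinForm ℝ (J → ℝ)) :
    Continuous fun u : J → ℝ => b u u := by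
  classical
  have h : (fun u : J → ℝ => b u u) = fun u => ∑ i, ∑ j, u i * (u j *
      b (Pi.single j 1) (Pi.single i 1)) := by
    funext u
    conv_lhs => rw [pi_eq_sum_univ' u]
    simp [Finset.mul_sum]
  rw [h]
  fun_prop

/-- A Hoffman-type error bound for a positive semi-definite form. -/
lemma exists_conformal_null_near {b : LinearMap.BilinForm ℝ (J → ℝ)}
    (hsymm : ∀ x y, b x y = b y x) (hnn : ∀ x, 0 ≤ b x x) :
    ∃ c : ℝ, 0 < c ∧ ∀ v : J → ℝ, ∃ n : J → ℝ, b n = 0 ∧ (∀ j, n j ∈ Set.uIcc 0 (v j)) ∧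
      c * ‖v - n‖ ^ 2 ≤ b v v := by
  classical
  have hcont := continuous_form_self b
  -- The condition on the kernel sits under the existential, so every sign pattern has a constant
  -- (`1` by default). There are finitely many patterns, so the least constant serves all `v`.
  have hpat : ∀ s : J → SignType, ∃ c : ℝ, 0 < c ∧
      ((∀ k ∈ LinearMap.ker b, k ∈ signCone s → k = 0) → ∀ u ∈ signCone s, c * ‖u‖ ^ 2 ≤ b u u) := by
    intro s
    by_cases hs : ∀ k ∈ LinearMap.ker b, k ∈ signCone s → k = 0
    · obtain ⟨c, hc, h⟩ := exists_mul_sq_norm_le_of_pos_on_cone (isClosed_signCone s)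
        (fun u hu t ht => smul_mem_signCone hu ht) hcont
        (fun t u => by simp [sq, mul_assoc]) (fun u hu hne => by
          refine lt_of_le_of_ne (hnn u) fun h0 => hne (hs u ?_ hu)
          exact LinearMap.mem_ker.2 (LinearMap.ext fun y => form_apply_eq_zero hsymm hnn h0.symm y))
      exact ⟨c, hc, fun _ => h⟩
    · exact ⟨1, one_pos, fun h => absurd h hs⟩
  choose c hc hcb using hpat
  obtain ⟨s₀, hs₀⟩ := Finite.exists_min c
  refine ⟨c s₀, hc s₀, fun v => ?_⟩
  obtain ⟨n, hn, hbox, hmax⟩ := exists_maximal_conformal (LinearMap.ker b) v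
  have hn0 : b n = 0 := LinearMap.mem_ker.1 hn
  refine ⟨n, hn0, hbox, ?_⟩
  have h1 := hcb _ hmax (v - n) (fun j => by simp [sign_mul_self])
  have h2 : b (v - n) (v - n) = b v v := by
    have : b v n = 0 := by rw [hsymm, hn0]; rfl
    simp [hn0, this]
  rw [h2] at h1
  exact (mul_le_mul_of_nonneg_right (hs₀ _) (by positivity)).trans h1

end Cone

/-! ### Growth of the one-variable terms -/

section OneDim

/-- On each half-line the function is linear. If its slope is zero there, `t' = t` works; otherwise
`t' = 0` does, since a nonzero linear function dominates a small multiple of `t ^ 2` on a bounded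
set. -/
lemma abs_growth {a lam : ℝ} (h : ∀ t : ℝ, 0 ≤ a * t + lam * |t|) (R : ℝ) :
    ∃ c : ℝ, 0 < c ∧ ∀ t : ℝ, |t| ≤ R → ∃ t' : ℝ, a * t' + lam * |t'| = 0 ∧
      c * (t - t') ^ 2 ≤ a * t + lam * |t| := by
  have hp : 0 ≤ lam + a := by simpa [add_comm] using h 1
  have hm : 0 ≤ lam - a := by have := h (-1); simp at this; linarith
  have key : ∀ q : ℝ, 0 ≤ q → ∃ c : ℝ, 0 < c ∧ (q ≠ 0 → c * (|R| + 1) ≤ q) := by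
    intro q hq
    rcases hq.eq_or_lt with h0 | h0
    · exact ⟨1, one_pos, fun h => absurd h0.symm h⟩
    · exact ⟨q / (|R| + 1), by positivity, fun _ => by field_simp; rfl⟩
  obtain ⟨c₁, hc₁, h₁⟩ := key _ hp
  obtain ⟨c₂, hc₂, h₂⟩ := key _ hm
  refine ⟨min c₁ c₂, lt_min hc₁ hc₂, fun t ht => ?_⟩
  by_cases h0 : a * t + lam * |t| = 0
  · exact ⟨t, h0, by simp [h0]⟩
  refine ⟨0, by simp, ?_⟩
  have hR : |t| ≤ |R| + 1 := by linarith [le_abs_self R]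
  rw [sub_zero]
  rcases le_total 0 t with hs | hs
  · rw [abs_of_nonneg hs] at h0 hR ⊢
    have hq : lam + a ≠ 0 := fun hc => h0 (by rw [← add_mul, add_comm, hc, zero_mul])
    calc min c₁ c₂ * t ^ 2 ≤ c₁ * t ^ 2 := by gcongr; exact min_le_left _ _
      _ = c₁ * t * t := by ring
      _ ≤ c₁ * (|R| + 1) * t := by gcongr
      _ ≤ (lam + a) * t := by gcongr; exact h₁ hq
      _ = a * t + lam * t := by ring
  · rw [abs_of_nonpos hs] at h0 hR ⊢
    have hq : lam - a ≠ 0 := fun hc => h0 (by linear_combination (-t) * hc)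
    have hs' : 0 ≤ -t := by linarith
    calc min c₁ c₂ * t ^ 2 ≤ c₂ * t ^ 2 := by gcongr; exact min_le_right _ _
      _ = c₂ * (-t) * (-t) := by ring
      _ ≤ c₂ * (|R| + 1) * (-t) := by gcongr
      _ ≤ (lam - a) * (-t) := by gcongr; exact h₂ hq
      _ = a * t + lam * (-t) := by ring

lemma log_growth {a s : ℝ} (hs : 0 < s)
    (h : ∀ t : ℝ, 0 < t → 0 ≤ a * (t - s) + -Real.log t - -Real.log s) (R : ℝ) :
    ∃ c : ℝ, 0 < c ∧ ∀ t : ℝ, 0 < t → t ≤ R →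
      c * (t - s) ^ 2 ≤ a * (t - s) + -Real.log t - -Real.log s := by
  have hder : HasDerivAt (fun t : ℝ => a * (t - s) + -Real.log t - -Real.log s)
      (a * 1 + -s⁻¹) s :=
    ((((hasDerivAt_id s).sub_const s).const_mul a).add (Real.hasDerivAt_log hs.ne').neg).sub_const _
  have hmin : IsLocalMin (fun t : ℝ => a * (t - s) + -Real.log t - -Real.log s) s := by
    filter_upwards [lt_mem_nhds hs] with t ht
    simpa using h t ht
  have ha : a = s⁻¹ := by linarith [hmin.hasDerivAt_eq_zero hder]
  refine ⟨1 / (s ^ 2 * (√(|R| / s) + 1) ^ 2), by positivity, fun t ht htR => ?_⟩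
  -- With `t = s * q ^ 2` and `a = s⁻¹` the excess is `q ^ 2 - 1 - 2 * log q`, which is at least `(q
  -- - 1) ^ 2` because `log q ≤ q - 1`.
  obtain ⟨q, hq, hqt⟩ : ∃ q : ℝ, 0 < q ∧ t = s * q ^ 2 :=
    ⟨√(t / s), by positivity, by rw [Real.sq_sqrt (by positivity)]; field_simp⟩
  have hqR : q ≤ √(|R| / s) := by
    refine Real.le_sqrt_of_sq_le ?_
    rw [le_div_iff₀ hs]
    linarith [le_abs_self R]
  have hlog : Real.log t = Real.log s + 2 * Real.log q := by
    rw [hqt, Real.log_mul hs.ne' (by positivity), Real.log_pow]; norm_num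
  have hlq := Real.log_le_sub_one_of_pos hq
  have h1 : (q - 1) ^ 2 ≤ a * (t - s) + -Real.log t - -Real.log s := by
    have : a * (t - s) = q ^ 2 - 1 := by rw [ha, hqt]; field_simp
    rw [this, hlog]
    nlinarith
  refine le_trans ?_ h1
  rw [hqt, div_mul_eq_mul_div, div_le_iff₀ (by positivity), one_mul]
  have h2 : (q + 1) ^ 2 ≤ (√(|R| / s) + 1) ^ 2 := by gcongr
  calc (s * q ^ 2 - s) ^ 2 = (q - 1) ^ 2 * (s ^ 2 * (q + 1) ^ 2) := by ring
    _ ≤ (q - 1) ^ 2 * (s ^ 2 * (√(|R| / s) + 1) ^ 2) := by gcongr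

lemma nonneg_of_quadratic_nonneg {a c : ℝ} (h : ∀ t : ℝ, 0 < t → t ≤ 1 → 0 ≤ t * a + t ^ 2 * c) :
    0 ≤ a := by
  have hev : ∀ᶠ t : ℝ in nhdsWithin 0 (Set.Ioi 0), 0 ≤ a + t * c := by
    filter_upwards [Ioc_mem_nhdsGT (zero_lt_one' ℝ)] with t ht
    have := h t ht.1 ht.2
    exact nonneg_of_mul_nonneg_right (a := t) (by linarith) ht.1
  have hlim : Filter.Tendsto (fun t : ℝ => a + t * c) (nhdsWithin 0 (Set.Ioi 0)) (nhds a) := by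
    have : Filter.Tendsto (fun t : ℝ => a + t * c) (nhds 0) (nhds (a + 0 * c)) :=
      (show Continuous fun t : ℝ => a + t * c by fun_prop).tendsto 0
    simp only [zero_mul, add_zero] at this
    exact this.mono_left nhdsWithin_le_nhds
  exact ge_of_tendsto hlim hev

end OneDim

/-! ### The abstract objective and its coordinate minimizers -/

/-- A convex objective on `J → ℝ`: a positive semi-definite quadratic form plus `-log` of the
coordinates in `barrier` plus `weight` times the absolute values of the other coordinates. -/
structure Model (J : Type*) [Fintype J] [DecidableEq J] where
  form : LinearMap.BilinForm ℝ (J → ℝ)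
  barrier : Finset J
  weight : ℝ
  symm : ∀ x y, form x y = form y x
  nonneg : ∀ x, 0 ≤ form x x
  diag_pos : ∀ j, 0 < form (Pi.single j 1) (Pi.single j 1)
  barrier_pos : ∀ x, x ≠ 0 → (∀ j, j ∉ barrier → x j = 0) → 0 < form x x
  weight_pos : 0 < weight

namespace Model

variable {J : Type*} [Fintype J] [DecidableEq J] (M : Model J)

/-- The separable convex term of the objective at the coordinate `j`. -/
noncomputable def pen (j : J) (t : ℝ) : ℝ := if j ∈ M.barrier then -Real.log t else M.weight * |t|

/-- The domain of `pen j`. -/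
def ray (j : J) : Set ℝ := if j ∈ M.barrier then Set.Ioi 0 else Set.univ

/-- The effective domain of the objective. -/
def dom : Set (J → ℝ) := {x | ∀ j, x j ∈ M.ray j}

/-- The objective. -/
noncomputable def obj (x : J → ℝ) : ℝ := 1 / 2 * M.form x x + ∑ j, M.pen j (x j)

lemma convexOn_pen (j : J) : ConvexOn ℝ (M.ray j) (M.pen j) := by
  by_cases hj : j ∈ M.barrier
  · have h1 : M.ray j = Set.Ioi 0 := if_pos hj
    have h2 : M.pen j = fun t => -Real.log t := funext fun t => if_pos hj
    rw [h1, h2]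
    exact strictConcaveOn_log_Ioi.concaveOn.neg
  · have h1 : M.ray j = Set.univ := if_neg hj
    have h2 : M.pen j = fun t => M.weight * |t| := funext fun t => if_neg hj
    rw [h1, h2]
    exact (convexOn_norm convex_univ).smul M.weight_pos.le

lemma continuousOn_pen (j : J) : ContinuousOn (M.pen j) (M.ray j) := by
  by_cases hj : j ∈ M.barrier
  · have h1 : M.ray j = Set.Ioi 0 := if_pos hj
    have h2 : M.pen j = fun t => -Real.log t := funext fun t => if_pos hj
    rw [h1, h2]
    exact (Real.continuousOn_log.mono fun t ht => (ne_of_gt ht : t ≠ 0)).neg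
  · have h2 : M.pen j = fun t => M.weight * |t| := funext fun t => if_neg hj
    rw [h2]
    fun_prop

lemma continuousOn_obj : ContinuousOn M.obj M.dom := by
  refine (continuous_const.mul (continuous_form_self M.form)).continuousOn.add
    (continuousOn_finsetSum _ fun j _ => ?_)
  exact (M.continuousOn_pen j).comp (by fun_prop) fun x hx => hx j

/-- The exact first-order expansion of the objective. -/
lemma obj_sub_obj (x y : J → ℝ) :
    M.obj y - M.obj x = 1 / 2 * M.form (y - x) (y - x) +
      ∑ j, (M.form x (Pi.single j 1) * (y j - x j) + M.pen j (y j) - M.pen j (x j)) := by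
  have h : ∑ j, M.form x (Pi.single j 1) * (y j - x j) = M.form x (y - x) := by
    conv_rhs => rw [pi_eq_sum_univ' (y - x)]
    simp [mul_comm]
  simp only [Finset.sum_sub_distrib, Finset.sum_add_distrib, h, obj]
  simp only [map_sub, LinearMap.sub_apply, M.symm y x]
  ring

lemma update_mem_dom {y : J → ℝ} (hy : y ∈ M.dom) {j : J} {w : ℝ} (hw : w ∈ M.ray j) :
    Function.update y j w ∈ M.dom := by
  intro k
  by_cases hk : k = j
  · subst hk; simpa using hw
  · simpa [Function.update_of_ne hk] using hy k

lemma obj_update_sub (y : J → ℝ) (j : J) (w : ℝ) :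
    M.obj (Function.update y j w) - M.obj y =
      1 / 2 * M.form (Pi.single j 1) (Pi.single j 1) * (w - y j) ^ 2 +
      (M.form y (Pi.single j 1) * (w - y j) + M.pen j w - M.pen j (y j)) := by
  rw [obj_sub_obj]
  have h1 : Function.update y j w - y = (w - y j) • Pi.single j (1 : ℝ) := by
    ext k
    by_cases hk : k = j
    · subst hk; simp
    · simp [hk]
  rw [h1, Finset.sum_eq_single j]
  · simp
    ring
  · intro k _ hk
    simp [hk]
  · simp

/-- The first-order condition at a point that is minimal in the direction of one coordinate. -/
lemma first_order_nonneg {y : J → ℝ} (hy : y ∈ M.dom) {j : J}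
    (hmin : ∀ w ∈ M.ray j, M.obj y ≤ M.obj (Function.update y j w)) {w : ℝ} (hw : w ∈ M.ray j) :
    0 ≤ M.form y (Pi.single j 1) * (w - y j) + M.pen j w - M.pen j (y j) := by
  -- Moving a fraction `t` of the way to `w` changes the objective by at most `t` times the claimed
  -- quantity plus `t ^ 2 * c`, by convexity of the penalty.
  refine nonneg_of_quadratic_nonneg
    (c := 1 / 2 * M.form (Pi.single j 1) (Pi.single j 1) * (w - y j) ^ 2) fun t ht0 ht1 => ?_
  have hc := M.convexOn_pen j
  have hmem := hc.1 (hy j) hw (sub_nonneg.2 ht1) ht0.le (by ring)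
  have hle := hc.2 (hy j) hw (sub_nonneg.2 ht1) ht0.le (by ring)
  have hm := sub_nonneg.2 (hmin _ hmem)
  rw [obj_update_sub] at hm
  simp only [smul_eq_mul] at hm hle
  have h1 : (1 - t) * y j + t * w - y j = t * (w - y j) := by ring
  rw [h1] at hm
  nlinarith

/-- `y` minimizes the objective among the points that differ from `x` in the coordinate `j` only. -/
def IsCoordArgmin (j : J) (x y : J → ℝ) : Prop :=
  y ∈ M.dom ∧ (∀ k, k ≠ j → y k = x k) ∧
    ∀ w ∈ M.dom, (∀ k, k ≠ j → w k = x k) → M.obj y ≤ M.obj w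

variable {M}

lemma IsCoordArgmin.first_order {j : J} {x y : J → ℝ} (h : M.IsCoordArgmin j x y) {w : ℝ}
    (hw : w ∈ M.ray j) :
    0 ≤ M.form y (Pi.single j 1) * (w - y j) + M.pen j w - M.pen j (y j) :=
  M.first_order_nonneg h.1 (fun _ hw => h.2.2 _ (M.update_mem_dom h.1 hw) fun k hk => by
    rw [Function.update_of_ne hk, h.2.1 k hk]) hw

/-- The expansion in one coordinate is exact and its first-order part is nonnegative, so the
quadratic term remains. This gives uniqueness of the update and sufficient decrease. -/
lemma IsCoordArgmin.gap {j : J} {x y w : J → ℝ} (h : M.IsCoordArgmin j x y) (hw : w ∈ M.dom)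
    (hwx : ∀ k, k ≠ j → w k = x k) :
    1 / 2 * M.form (Pi.single j 1) (Pi.single j 1) * (w j - y j) ^ 2 ≤ M.obj w - M.obj y := by
  have hup : w = Function.update y j (w j) := by
    ext k
    by_cases hk : k = j
    · subst hk; simp
    · rw [Function.update_of_ne hk, hwx k hk, h.2.1 k hk]
  rw [hup, obj_update_sub, Function.update_self]
  linarith [h.first_order (hw j)]

lemma IsCoordArgmin.unique {j : J} {x y y' : J → ℝ} (h : M.IsCoordArgmin j x y)
    (h' : M.IsCoordArgmin j x y') : y' = y := by
  ext k
  by_cases hk : k = j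
  · subst hk
    have h1 := h.gap h'.1 h'.2.1
    have h2 := h'.2.2 y h.1 h.2.1
    have h3 := M.diag_pos k
    have h4 : (y' k - y k) ^ 2 ≤ 0 := by
      by_contra hc
      have := mul_pos (mul_pos one_half_pos h3) (not_le.1 hc)
      linarith
    exact sub_eq_zero.1 (pow_eq_zero_iff two_ne_zero |>.1 (le_antisymm h4 (sq_nonneg _)))
  · rw [h'.2.1 k hk, h.2.1 k hk]

variable (M)

/-- The absolute values control the non-barrier coordinates, and `barrier_pos` makes the form
definite where these vanish. Jointly they grow linearly, which the logarithms cannot offset. -/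
lemma exists_coercive_bound : ∃ c C : ℝ, 0 < c ∧ ∀ x ∈ M.dom, c * ‖x‖ ≤ M.obj x + C := by
  let ψ : (J → ℝ) → J → ℝ := fun u j => if j ∈ M.barrier then 0 else M.weight * |u j|
  have hψ : ∀ u j, 0 ≤ ψ u j := by
    intro u j
    by_cases hj : j ∈ M.barrier
    · simp [ψ, hj]
    · simp only [ψ, hj, if_false]
      exact mul_nonneg M.weight_pos.le (abs_nonneg _)
  obtain ⟨c, hc, hcb⟩ := exists_mul_sq_norm_le_of_pos_on_cone (K := Set.univ) isClosed_univ
    (fun _ _ _ _ => trivial) (f := fun u => M.form u u + ∑ j, ψ u j ^ 2)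
    (by
      refine (continuous_form_self M.form).add (continuous_finsetSum _ fun j _ => ?_)
      by_cases hj : j ∈ M.barrier
      · simp only [ψ, hj, if_true]; fun_prop
      · simp only [ψ, hj, if_false]; fun_prop)
    (by
      intro t u
      have h1 : ∀ j, ψ (t • u) j ^ 2 = t ^ 2 * ψ u j ^ 2 := by
        intro j
        by_cases hj : j ∈ M.barrier
        · simp [ψ, hj]
        · simp [ψ, hj, abs_mul, mul_pow]; ring
      simp only [h1, map_smul, LinearMap.smul_apply, smul_eq_mul, ← Finset.mul_sum]
      ring)
    (by
      intro u _ hne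
      by_cases hz : ∀ j, j ∉ M.barrier → u j = 0
      · exact add_pos_of_pos_of_nonneg (M.barrier_pos u hne hz)
          (Finset.sum_nonneg fun j _ => sq_nonneg _)
      · push Not at hz
        obtain ⟨j, hj, hj0⟩ := hz
        refine add_pos_of_nonneg_of_pos (M.nonneg u)
          (Finset.sum_pos' (fun j _ => sq_nonneg _) ⟨j, Finset.mem_univ _, ?_⟩)
        have h1 := abs_pos.2 hj0
        have h2 := M.weight_pos
        simp only [ψ, hj, if_false]
        positivity)
  have hs : 0 < √c := Real.sqrt_pos.2 hc
  set n : ℝ := (Fintype.card J : ℝ) with hn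
  have hn0 : 0 ≤ n := Nat.cast_nonneg _
  -- Since `log (ε * t) ≤ ε * t - 1`, this choice lets all the logarithms together cost at most half
  -- of the linear growth `√c * ‖x‖`, up to a constant.
  set ε : ℝ := √c / (2 * (n + 1)) with hε
  have hε0 : 0 < ε := by positivity
  have hnε : n * ε ≤ √c / 2 := by
    rw [hε, ← mul_div_assoc, div_le_div_iff₀ (by positivity) two_pos]
    nlinarith
  refine ⟨√c / 2, 1 / 2 + n * |1 + Real.log ε|, by positivity, fun x hx => ?_⟩
  have hsum : 0 ≤ ∑ j, ψ x j := Finset.sum_nonneg fun j _ => hψ x j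
  have hpen : ∀ j ∈ Finset.univ, ψ x j - (ε * ‖x‖ + |1 + Real.log ε|) ≤ M.pen j (x j) := by
    intro j _
    by_cases hj : j ∈ M.barrier
    · have hxj : 0 < x j := by simpa [ray, hj] using hx j
      have h1 := Real.log_le_sub_one_of_pos (mul_pos hε0 hxj)
      rw [Real.log_mul hε0.ne' hxj.ne'] at h1
      have h2 : ε * x j ≤ ε * ‖x‖ := by
        gcongr
        exact (le_abs_self _).trans (norm_le_pi_norm x j)
      simp only [ψ, pen, hj, if_true]
      linarith [neg_abs_le (1 + Real.log ε)]
    · simp only [ψ, pen, hj, if_false]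
      have : 0 ≤ ε * ‖x‖ + |1 + Real.log ε| := by positivity
      linarith
  have h1 := Finset.sum_le_sum hpen
  simp only [Finset.sum_sub_distrib, Finset.sum_const, Finset.card_univ, nsmul_eq_mul, ← hn] at h1
  have h2 : √c * ‖x‖ ≤ √(M.form x x) + ∑ j, ψ x j := by
    refine abs_le_of_sq_le_sq' ?_ (by positivity) |>.2
    have h3 := hcb x trivial
    have h4 : ∑ j, ψ x j ^ 2 ≤ (∑ j, ψ x j) ^ 2 :=
      Finset.sum_sq_le_sq_sum_of_nonneg fun j _ => hψ x j
    have h5 := Real.sq_sqrt (M.nonneg x)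
    have h6 := Real.sq_sqrt hc.le
    have h7 := mul_nonneg (Real.sqrt_nonneg (M.form x x)) hsum
    nlinarith
  have h3 := Real.sq_sqrt (M.nonneg x)
  have h4 : n * ε * ‖x‖ ≤ √c / 2 * ‖x‖ := by gcongr
  unfold obj
  nlinarith [sq_nonneg (√(M.form x x) - 1)]

lemma exists_norm_le_of_obj_le (m : ℝ) :
    ∃ R : ℝ, 0 ≤ R ∧ ∀ x ∈ M.dom, M.obj x ≤ m → ‖x‖ ≤ R := by
  obtain ⟨c, C, hc, h⟩ := M.exists_coercive_bound
  refine ⟨|(m + C) / c|, abs_nonneg _, fun x hx hm => le_trans ?_ (le_abs_self _)⟩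
  rw [le_div_iff₀ hc]
  linarith [h x hx]

/-- Each penalty is at least `-R` on the sublevel set, so a bounded objective keeps every barrier
coordinate above a fixed `η > 0`, away from the open boundary of the domain. -/
lemma isCompact_sublevel (m : ℝ) : IsCompact {x | x ∈ M.dom ∧ M.obj x ≤ m} := by
  obtain ⟨R, hR0, hR⟩ := M.exists_norm_le_of_obj_le m
  set η : ℝ := Real.exp (-(m + Fintype.card J * R)) with hη
  set F : Set (J → ℝ) := {x | ∀ j, j ∈ M.barrier → η ≤ x j} with hF
  have hFc : IsClosed F := by
    simp only [hF, Set.ofPred_forall]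
    exact isClosed_iInter fun j => isClosed_iInter fun _ => isClosed_le (by fun_prop) (by fun_prop)
  have hFd : F ⊆ M.dom := by
    intro x hx j
    by_cases hj : j ∈ M.barrier
    · simpa [ray, hj] using (Real.exp_pos _).trans_le (hx j hj)
    · simp [ray, hj]
  have hsub : ∀ x ∈ M.dom, M.obj x ≤ m → x ∈ F := by
    intro x hx hm j hj
    have hxR := hR x hx hm
    have hpen : ∀ k, -R ≤ M.pen k (x k) := by
      intro k
      by_cases hk : k ∈ M.barrier
      · have hxk : 0 < x k := by simpa [ray, hk] using hx k
        have h1 := Real.log_le_sub_one_of_pos hxk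
        have h2 : x k ≤ ‖x‖ := (le_abs_self _).trans (norm_le_pi_norm x k)
        simp only [pen, hk, if_true]
        linarith
      · simp only [pen, hk, if_false]
        have := mul_nonneg M.weight_pos.le (abs_nonneg (x k))
        linarith
    have hxj : 0 < x j := by simpa [ray, hj] using hx j
    have h1 : M.pen j (x j) + ∑ k ∈ Finset.univ.erase j, M.pen k (x k) = ∑ k, M.pen k (x k) :=
      Finset.add_sum_erase _ (fun k => M.pen k (x k)) (Finset.mem_univ j)
    have h2 : ∑ k ∈ Finset.univ.erase j, -R ≤ ∑ k ∈ Finset.univ.erase j, M.pen k (x k) :=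
      Finset.sum_le_sum fun k _ => hpen k
    have h3 : ((Finset.univ.erase j).card : ℝ) * R ≤ Fintype.card J * R := by
      gcongr
      exact Finset.card_le_univ _
    simp only [Finset.sum_const, nsmul_eq_mul, mul_neg] at h2
    have h4 := M.nonneg x
    have h5 : M.pen j (x j) = -Real.log (x j) := by simp [pen, hj]
    rw [hη, ← Real.le_log_iff_exp_le hxj]
    unfold obj at hm
    linarith
  have heq : {x | x ∈ M.dom ∧ M.obj x ≤ m} = F ∩ M.obj ⁻¹' Set.Iic m := by
    ext x
    exact ⟨fun h => ⟨hsub x h.1 h.2, h.2⟩, fun h => ⟨hFd h.1, h.2⟩⟩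
  refine Metric.isCompact_of_isClosed_isBounded ?_ ?_
  · rw [heq]
    exact (M.continuousOn_obj.mono hFd).preimage_isClosed_of_isClosed hFc isClosed_Iic
  · exact (Metric.isBounded_closedBall (x := (0 : J → ℝ)) (r := R)).subset fun x hx => by
      simpa using hR x hx.1 hx.2

lemma exists_argmin_on_closed {K : Set (J → ℝ)} (hK : IsClosed K) {x₀ : J → ℝ} (hx₀ : x₀ ∈ M.dom)
    (hx₀K : x₀ ∈ K) : ∃ y ∈ M.dom, y ∈ K ∧ ∀ w ∈ M.dom, w ∈ K → M.obj y ≤ M.obj w := by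
  obtain ⟨y, hy, hmin⟩ := ((M.isCompact_sublevel (M.obj x₀)).inter_right hK).exists_isMinOn
    ⟨x₀, ⟨hx₀, le_rfl⟩, hx₀K⟩ (M.continuousOn_obj.mono fun x hx => hx.1.1)
  refine ⟨y, hy.1.1, hy.2, fun w hw hwK => ?_⟩
  rcases le_total (M.obj w) (M.obj x₀) with h | h
  · exact hmin ⟨⟨hw, h⟩, hwK⟩
  · exact hy.1.2.trans h

lemma exists_isCoordArgmin (j : J) {x : J → ℝ} (hx : x ∈ M.dom) :
    ∃ y, M.IsCoordArgmin j x y := by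
  have hK : IsClosed {w : J → ℝ | ∀ k, k ≠ j → w k = x k} := by
    simp only [Set.ofPred_forall]
    exact isClosed_iInter fun k => isClosed_iInter fun _ => isClosed_eq (by fun_prop) (by fun_prop)
  obtain ⟨y, hy, hyK, hmin⟩ := M.exists_argmin_on_closed hK hx fun _ _ => rfl
  exact ⟨y, hy, hyK, hmin⟩

lemma exists_form_bound : ∃ L : ℝ, 0 < L ∧ (∀ u j, |M.form u (Pi.single j 1)| ≤ L * ‖u‖) ∧
    ∀ u, M.form u u ≤ L * ‖u‖ ^ 2 := by
  set L₀ : ℝ := ∑ i, ∑ j, |M.form (Pi.single i 1) (Pi.single j 1)| with hL₀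
  have hL₀0 : 0 ≤ L₀ := Finset.sum_nonneg fun i _ => Finset.sum_nonneg fun j _ => abs_nonneg _
  have h1 : ∀ u j, |M.form u (Pi.single j 1)| ≤ L₀ * ‖u‖ := by
    intro u j
    have hu : M.form u (Pi.single j 1) =
        ∑ i, u i * M.form (Pi.single i 1) (Pi.single j 1) := by
      conv_lhs => rw [pi_eq_sum_univ' u]
      simp
    rw [hu, hL₀, Finset.sum_mul]
    refine (Finset.abs_sum_le_sum_abs _ _).trans (Finset.sum_le_sum fun i _ => ?_)
    rw [abs_mul, mul_comm]
    refine mul_le_mul ?_ (norm_le_pi_norm u i) (abs_nonneg _)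
      (Finset.sum_nonneg fun j _ => abs_nonneg _)
    exact Finset.single_le_sum (f := fun j => |M.form (Pi.single i 1) (Pi.single j 1)|)
      (fun j _ => abs_nonneg _) (Finset.mem_univ j)
  set n : ℝ := (Fintype.card J : ℝ) with hn
  have hn0 : 0 ≤ n := Nat.cast_nonneg _
  refine ⟨L₀ * (n + 1) + 1, by positivity, fun u j => (h1 u j).trans ?_, fun u => ?_⟩
  · gcongr
    nlinarith
  · have hu : M.form u u = ∑ j, u j * M.form u (Pi.single j 1) := by
      conv_lhs => rw [pi_eq_sum_univ' u]
      rw [map_sum]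
      simp [← pi_eq_sum_univ']
    rw [hu]
    have h2 : ∀ j ∈ Finset.univ, u j * M.form u (Pi.single j 1) ≤ ‖u‖ * (L₀ * ‖u‖) := by
      intro j _
      refine (le_abs_self _).trans ?_
      rw [abs_mul]
      exact mul_le_mul (norm_le_pi_norm u j) (h1 u j) (abs_nonneg _) (norm_nonneg _)
    have h3 := Finset.sum_le_sum h2
    simp only [Finset.sum_const, Finset.card_univ, nsmul_eq_mul, ← hn] at h3
    nlinarith [mul_nonneg hL₀0 (sq_nonneg ‖u‖), sq_nonneg ‖u‖]

end Model

lemma exists_pos_le_of_finite {ι : Type*} [Finite ι] {f : ι → ℝ} (hf : ∀ i, 0 < f i) :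
    ∃ c : ℝ, 0 < c ∧ ∀ i, c ≤ f i := by
  rcases isEmpty_or_nonempty ι with h | h
  · exact ⟨1, one_pos, fun i => h.elim i⟩
  · obtain ⟨i, hi⟩ := Finite.exists_min f
    exact ⟨f i, hf i, hi⟩

/-! ### Quadratic growth around the minimizers -/

namespace Model

variable {J : Type*} [Fintype J] [DecidableEq J] (M : Model J)

lemma exists_pen_growth {j : J} {a s : ℝ} (hs : s ∈ M.ray j)
    (h : ∀ t ∈ M.ray j, 0 ≤ a * (t - s) + M.pen j t - M.pen j s) (R : ℝ) :
    ∃ c : ℝ, 0 < c ∧ ∀ t ∈ M.ray j, |t| ≤ R → ∃ t' ∈ M.ray j,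
      a * (t' - s) + M.pen j t' - M.pen j s = 0 ∧
      c * (t - t') ^ 2 ≤ a * (t - s) + M.pen j t - M.pen j s := by
  by_cases hj : j ∈ M.barrier
  · simp only [ray, pen, hj, if_true, Set.mem_Ioi] at hs h ⊢
    obtain ⟨c, hc, hcb⟩ := log_growth (a := a) hs h R
    refine ⟨c, hc, fun t ht htR => ⟨s, hs, by ring, ?_⟩⟩
    linarith [hcb t ht ((le_abs_self t).trans htR)]
  · simp only [ray, pen, hj, if_false, Set.mem_univ, true_and, forall_const] at h ⊢
    -- Comparison with `t = 0` and `t = 2 * s` gives the two inequalities.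
    have h0 : a * s + M.weight * |s| = 0 := by
      have h1 := h 0
      have h2 := h (2 * s)
      rw [abs_mul, abs_two] at h2
      rw [abs_zero] at h1
      linarith
    obtain ⟨c, hc, hcb⟩ := abs_growth (a := a) (lam := M.weight)
      (fun t => by linarith [h t]) R
    refine ⟨c, hc, fun t htR => ?_⟩
    obtain ⟨t', ht', hb⟩ := hcb t htR
    exact ⟨t', by linarith, by linarith⟩

/-- Quadratic growth of the objective away from its set of minimizers, on bounded sets. -/
lemma exists_quadratic_growth {xs : J → ℝ} (hxs : xs ∈ M.dom)
    (hmin : ∀ w ∈ M.dom, M.obj xs ≤ M.obj w) (R : ℝ) :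
    ∃ c : ℝ, 0 < c ∧ ∀ y ∈ M.dom, ‖y‖ ≤ R → ∃ xb ∈ M.dom, M.obj xb = M.obj xs ∧
      c * ‖y - xb‖ ^ 2 ≤ M.obj y - M.obj xs := by
  set H : J → ℝ → ℝ := fun j t =>
    M.form xs (Pi.single j 1) * (t - xs j) + M.pen j t - M.pen j (xs j) with hH
  have hH0 : ∀ j, ∀ t ∈ M.ray j, 0 ≤ H j t := fun j t ht =>
    M.first_order_nonneg hxs (fun w hw => hmin _ (M.update_mem_dom hxs hw)) ht
  have hexp : ∀ y, M.obj y - M.obj xs = 1 / 2 * M.form (y - xs) (y - xs) + ∑ j, H j (y j) :=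
    fun y => M.obj_sub_obj xs y
  choose cj hcj hgrow using fun j => M.exists_pen_growth (hxs j) (hH0 j) R
  obtain ⟨c₂, hc₂, hc₂le⟩ := exists_pos_le_of_finite hcj
  obtain ⟨c₁, hc₁, hhoff⟩ := exists_conformal_null_near M.symm M.nonneg
  obtain ⟨L, hL, -, hLf⟩ := M.exists_form_bound
  set κ : ℝ := 2 / c₂ + 8 / c₁ + 4 * L / (c₁ * c₂) with hκ
  have hκ0 : 0 < κ := by positivity
  refine ⟨κ⁻¹, by positivity, fun y hy hyR => ?_⟩
  -- `P` annihilates every separable term but need not be a minimizer, since the form may be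
  -- positive at `P - xs`.
  choose P hPray hP0 hPle using fun j =>
    hgrow j (y j) (hy j) ((norm_le_pi_norm y j).trans hyR)
  obtain ⟨n, hn0, hbox, hnear⟩ := hhoff (P - xs)
  have hseg : ∀ j, (xs + n) j ∈ Set.uIcc (xs j) (P j) := by
    intro j
    have := hbox j
    simp only [Pi.sub_apply, Pi.add_apply, Set.mem_uIcc] at this ⊢
    rcases this with h | h
    · left; constructor <;> linarith
    · right; constructor <;> linarith
  have hconvH : ∀ j, Convex ℝ {t | t ∈ M.ray j ∧ H j t ≤ 0} := by
    intro j
    have hlin : ConvexOn ℝ (M.ray j) fun t : ℝ =>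
        M.form xs (Pi.single j 1) * (t - xs j) - M.pen j (xs j) :=
      ⟨(M.convexOn_pen j).1, fun t _ u _ p q _ _ hpq => by
        simp only [smul_eq_mul]
        obtain rfl : q = 1 - p := by linarith
        apply le_of_eq
        ring⟩
    have := ((M.convexOn_pen j).add hlin).convex_le 0
    convert this using 4
    simp only [hH, Pi.add_apply]
    constructor <;> intro h <;> linarith
  -- The zero set of `H j` is an interval containing `xs j` and `P j`, hence everything between
  -- them.
  have hmem : ∀ j, (xs + n) j ∈ M.ray j ∧ H j ((xs + n) j) ≤ 0 := fun j =>
    (hconvH j).ordConnected.uIcc_subset ⟨hxs j, by simp [hH]⟩ ⟨hPray j, (hP0 j).le⟩ (hseg j)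
  have hxb : xs + n ∈ M.dom := fun j => (hmem j).1
  refine ⟨xs + n, hxb, ?_, ?_⟩
  · have h1 := hexp (xs + n)
    have h2 : ∑ j, H j ((xs + n) j) ≤ 0 := Finset.sum_nonpos fun j _ => (hmem j).2
    have h3 := hmin _ hxb
    simp only [add_sub_cancel_left, hn0, LinearMap.zero_apply] at h1
    linarith
  · set A : ℝ := 1 / 2 * M.form (y - xs) (y - xs) with hA
    set B : ℝ := ∑ j, H j (y j) with hB
    have hA0 : 0 ≤ A := mul_nonneg one_half_pos.le (M.nonneg _)
    have hB0 : 0 ≤ B := Finset.sum_nonneg fun j _ => hH0 j _ (hy j)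
    have h1 : c₂ * ‖y - P‖ ^ 2 ≤ B := by
      have : ‖y - P‖ ≤ √(B / c₂) := by
        refine (pi_norm_le_iff_of_nonneg (Real.sqrt_nonneg _)).2 fun j => ?_
        refine Real.le_sqrt_of_sq_le ?_
        rw [Real.norm_eq_abs, sq_abs, le_div_iff₀ hc₂, mul_comm]
        calc c₂ * ((y - P) j) ^ 2 ≤ cj j * (y j - P j) ^ 2 := by
              simp only [Pi.sub_apply]
              gcongr
              exact hc₂le j
          _ ≤ H j (y j) := hPle j
          _ ≤ B := Finset.single_le_sum (f := fun j => H j (y j))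
              (fun j _ => hH0 j _ (hy j)) (Finset.mem_univ j)
      have h2 : ‖y - P‖ ^ 2 ≤ B / c₂ := by
        rw [← Real.sq_sqrt (show 0 ≤ B / c₂ by positivity)]
        gcongr
      rw [le_div_iff₀ hc₂] at h2
      linarith
    -- Parallelogram inequality for `P - xs = (y - xs) - (y - P)`.
    have h2 : M.form (P - xs) (P - xs) ≤ 4 * A + 2 * L * ‖y - P‖ ^ 2 := by
      have h3 := hLf (y - P)
      have h4 := M.nonneg ((y - xs) + (y - P))
      have h5 : P - xs = (y - xs) - (y - P) := by abel
      rw [h5]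
      simp only [hA]
      generalize y - xs = p at *
      generalize y - P = q at *
      simp only [map_sub, map_add, LinearMap.sub_apply, LinearMap.add_apply, M.symm q p] at h4 ⊢
      linarith
    have h3 : ‖y - (xs + n)‖ ≤ ‖y - P‖ + ‖P - xs - n‖ := by
      have : y - (xs + n) = (y - P) + (P - xs - n) := by abel
      rw [this]
      exact norm_add_le _ _
    have h4 : ‖y - (xs + n)‖ ^ 2 ≤ 2 * ‖y - P‖ ^ 2 + 2 * ‖P - xs - n‖ ^ 2 := by
      have := pow_le_pow_left₀ (norm_nonneg _) h3 2
      nlinarith [sq_nonneg (‖y - P‖ - ‖P - xs - n‖)]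
    have h5 : ‖y - P‖ ^ 2 ≤ B / c₂ := by rw [le_div_iff₀ hc₂]; linarith
    have h6 : ‖P - xs - n‖ ^ 2 ≤ (4 * A + 2 * L * (B / c₂)) / c₁ := by
      rw [le_div_iff₀ hc₁]
      have : 2 * L * ‖y - P‖ ^ 2 ≤ 2 * L * (B / c₂) := by gcongr
      linarith
    rw [hexp, ← hA, ← hB, inv_mul_le_iff₀ hκ0]
    have h7 : 2 * (B / c₂) + 2 * ((4 * A + 2 * L * (B / c₂)) / c₁) =
        2 / c₂ * B + 8 / c₁ * A + 4 * L / (c₁ * c₂) * B := by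
      field_simp
      ring
    have h8 : 0 ≤ 2 / c₂ * A := by positivity
    have h9 : 0 ≤ 8 / c₁ * B := by positivity
    have h10 : 0 ≤ 4 * L / (c₁ * c₂) * A := by positivity
    have h11 : κ * (A + B) = 2 / c₂ * A + 2 / c₂ * B + 8 / c₁ * A + 8 / c₁ * B +
      4 * L / (c₁ * c₂) * A + 4 * L / (c₁ * c₂) * B := by rw [hκ]; ring
    linarith

/-! ### Sweeps and linear convergence -/

/-- One cycle of coordinatewise minimization, with intermediate states `z 0, …, z (last N)`. -/
def IsSweep {N : ℕ} (e : Fin N ≃ J) (z : Fin (N + 1) → J → ℝ) : Prop :=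
  z 0 ∈ M.dom ∧ ∀ i : Fin N, M.IsCoordArgmin (e i) (z i.castSucc) (z i.succ)

variable {M} {N : ℕ} {e : Fin N ≃ J} {z : Fin (N + 1) → J → ℝ}

lemma IsSweep.mem_dom (h : M.IsSweep e z) (i : Fin (N + 1)) : z i ∈ M.dom := by
  cases i using Fin.cases with
  | zero => exact h.1
  | succ i => exact (h.2 i).1

lemma IsSweep.apply_eq_first (h : M.IsSweep e z) (j : J) (i : Fin (N + 1))
    (hi : i ≤ (e.symm j).castSucc) : z i j = z 0 j := by
  induction i using Fin.induction with
  | zero => rfl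
  | succ i ih =>
    have hlt : i < e.symm j := Fin.succ_le_castSucc_iff.1 hi
    rw [(h.2 i).2.1 j (fun hj => by simp [hj] at hlt)]
    exact ih (Fin.castSucc_le_castSucc_iff.2 hlt.le)

lemma IsSweep.apply_eq_succ (h : M.IsSweep e z) (j : J) (i : Fin (N + 1))
    (hi : (e.symm j).succ ≤ i) : z i j = z (e.symm j).succ j := by
  induction i using Fin.induction with
  | zero => simp at hi
  | succ i ih =>
    rcases eq_or_lt_of_le (Fin.succ_le_succ_iff.1 hi) with he | hlt
    · rw [he]
    · rw [(h.2 i).2.1 j (fun hj => by simp [hj] at hlt)]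
      exact ih (Fin.succ_le_castSucc_iff.2 hlt)

lemma IsSweep.apply_succ (h : M.IsSweep e z) (j : J) :
    z (e.symm j).succ j = z (Fin.last N) j :=
  (h.apply_eq_succ j _ (Fin.le_last _)).symm

lemma IsSweep.antitone_obj (h : M.IsSweep e z) : Antitone fun i => M.obj (z i) :=
  Fin.antitone_iff_succ_le.2 fun i => (h.2 i).2.2 _ (h.mem_dom _) fun _ _ => rfl

/-- As `e` is a bijection, each coordinate is updated once, so at any stage it has either its
initial or its final value. -/
lemma IsSweep.norm_sub_le (h : M.IsSweep e z) (i : Fin (N + 1)) :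
    ‖z (Fin.last N) - z i‖ ≤ ‖z (Fin.last N) - z 0‖ := by
  refine (pi_norm_le_iff_of_nonneg (norm_nonneg _)).2 fun j => ?_
  rcases le_or_gt i (e.symm j).castSucc with hi | hi
  · rw [Pi.sub_apply, h.apply_eq_first j i hi]
    exact norm_le_pi_norm (z (Fin.last N) - z 0) j
  · rw [Pi.sub_apply, h.apply_eq_succ j i (Fin.castSucc_lt_iff_succ_le.1 hi), h.apply_succ, sub_self,
      norm_zero]
    exact norm_nonneg _

variable (M) in
/-- A sweep decreases the objective by at least a multiple of its squared length. -/
lemma exists_sufficient_decrease : ∃ c : ℝ, 0 < c ∧ ∀ {N : ℕ} {e : Fin N ≃ J}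
    {z : Fin (N + 1) → J → ℝ}, M.IsSweep e z →
    c * ‖z (Fin.last N) - z 0‖ ^ 2 ≤ M.obj (z 0) - M.obj (z (Fin.last N)) := by
  obtain ⟨c, hc, hle⟩ := exists_pos_le_of_finite
    (f := fun j => 1 / 2 * M.form (Pi.single j 1) (Pi.single j 1))
    fun j => mul_pos one_half_pos (M.diag_pos j)
  refine ⟨c, hc, fun {N e z} h => ?_⟩
  set D := M.obj (z 0) - M.obj (z (Fin.last N))
  have hD : 0 ≤ D := sub_nonneg.2 (h.antitone_obj (Fin.zero_le _))
  have hn : ‖z (Fin.last N) - z 0‖ ≤ √(D / c) := by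
    refine (pi_norm_le_iff_of_nonneg (Real.sqrt_nonneg _)).2 fun j => Real.le_sqrt_of_sq_le ?_
    rw [Real.norm_eq_abs, sq_abs, le_div_iff₀ hc, mul_comm]
    have hgap := (h.2 (e.symm j)).gap (h.mem_dom _) fun _ _ => rfl
    rw [e.apply_symm_apply, h.apply_succ, h.apply_eq_first j _ le_rfl] at hgap
    have h1 : M.obj (z (e.symm j).castSucc) ≤ M.obj (z 0) := h.antitone_obj (Fin.zero_le _)
    have h2 : M.obj (z (Fin.last N)) ≤ M.obj (z (e.symm j).succ) := h.antitone_obj (Fin.le_last _)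
    calc c * ((z (Fin.last N) - z 0) j) ^ 2
        ≤ 1 / 2 * M.form (Pi.single j 1) (Pi.single j 1) * (z 0 j - z (Fin.last N) j) ^ 2 := by
          rw [Pi.sub_apply, ← neg_sub (z 0 j), neg_sq]
          gcongr
          exact hle j
      _ ≤ D := by simp only [D]; linarith
  have h2 : ‖z (Fin.last N) - z 0‖ ^ 2 ≤ D / c := by
    rw [← Real.sq_sqrt (show 0 ≤ D / c by positivity)]
    gcongr
  rw [le_div_iff₀ hc] at h2
  linarith

variable (M) in
-- Coordinate `j` keeps its value after its update, so its optimality condition there fails at the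
-- end of the sweep only by the change in the gradient of the quadratic part, of order the sweep
-- length.
lemma exists_suboptimality_bound : ∃ L : ℝ, 0 < L ∧ ∀ {N : ℕ} {e : Fin N ≃ J}
    {z : Fin (N + 1) → J → ℝ}, M.IsSweep e z → ∀ xb ∈ M.dom,
    M.obj (z (Fin.last N)) - M.obj xb ≤
      L * ‖z (Fin.last N) - z 0‖ * ‖z (Fin.last N) - xb‖ := by
  obtain ⟨L, hL, hLb, -⟩ := M.exists_form_bound
  refine ⟨L * (Fintype.card J + 1), by positivity, fun {N e z} h xb hxb => ?_⟩
  set y := z (Fin.last N) with hy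
  have hterm : ∀ j ∈ Finset.univ, -(L * ‖y - z 0‖ * ‖y - xb‖) ≤
      M.form y (Pi.single j 1) * (xb j - y j) + M.pen j (xb j) - M.pen j (y j) := by
    intro j _
    have hf := (h.2 (e.symm j)).first_order
      (show xb j ∈ M.ray (e (e.symm j)) by rw [e.apply_symm_apply]; exact hxb j)
    rw [e.apply_symm_apply, h.apply_succ, ← hy] at hf
    set w := z (e.symm j).succ
    have h1 : M.form y (Pi.single j 1) = M.form w (Pi.single j 1) +
        M.form (y - w) (Pi.single j 1) := by
      simp
    have h2 : |M.form (y - w) (Pi.single j 1) * (xb j - y j)| ≤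
        L * ‖y - z 0‖ * ‖y - xb‖ := by
      rw [abs_mul]
      refine mul_le_mul ((hLb _ _).trans ?_) ?_ (abs_nonneg _) (by positivity)
      · gcongr
        exact h.norm_sub_le _
      · rw [norm_sub_rev]
        exact norm_le_pi_norm (xb - y) j
    rw [h1]
    linarith [neg_abs_le (M.form (y - w) (Pi.single j 1) * (xb j - y j))]
  have hsum := Finset.sum_le_sum hterm
  simp only [Finset.sum_const, Finset.card_univ, nsmul_eq_mul] at hsum
  have hexp := M.obj_sub_obj y xb
  have hnn := M.nonneg (xb - y)
  have : 0 ≤ L * ‖y - z 0‖ * ‖y - xb‖ := by positivity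
  linarith

/-- Each sweep contracts the suboptimality by a fixed factor. -/
lemma exists_linear_decrease {xs : J → ℝ} (hxs : xs ∈ M.dom)
    (hmin : ∀ w ∈ M.dom, M.obj xs ≤ M.obj w) (m : ℝ) :
    ∃ C : ℝ, 0 < C ∧ ∀ {N : ℕ} {e : Fin N ≃ J} {z : Fin (N + 1) → J → ℝ}, M.IsSweep e z →
      M.obj (z 0) ≤ m →
      M.obj (z (Fin.last N)) - M.obj xs ≤ C * (M.obj (z 0) - M.obj (z (Fin.last N))) := by
  obtain ⟨c, hc, hdec⟩ := M.exists_sufficient_decrease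
  obtain ⟨L, hL, hsub⟩ := M.exists_suboptimality_bound
  obtain ⟨R, -, hR⟩ := M.exists_norm_le_of_obj_le m
  obtain ⟨a, ha, hgrow⟩ := M.exists_quadratic_growth hxs hmin R
  -- Squaring `δ ≤ L * s * d` and inserting `c * s ^ 2 ≤ D` and `a * d ^ 2 ≤ δ` gives `c * a * δ ^ 2
  -- ≤ L ^ 2 * D * δ`; a factor `δ` cancels.
  refine ⟨L ^ 2 / (c * a), by positivity, fun {N e z} h hm => ?_⟩
  have hle : M.obj (z (Fin.last N)) ≤ M.obj (z 0) := h.antitone_obj (Fin.zero_le _)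
  obtain ⟨xb, hxb, hobj, hg⟩ := hgrow _ (h.mem_dom (Fin.last N))
    (hR _ (h.mem_dom _) (hle.trans hm))
  have h1 := hdec h
  have h2 := hsub h xb hxb
  rw [hobj] at h2
  set δ := M.obj (z (Fin.last N)) - M.obj xs
  set D := M.obj (z 0) - M.obj (z (Fin.last N)) with hD
  have hD0 : 0 ≤ D := sub_nonneg.2 hle
  have hδ0 : 0 ≤ δ := sub_nonneg.2 (hmin _ (h.mem_dom _))
  rcases hδ0.eq_or_lt with h0 | h0
  · rw [← h0]
    positivity
  · rw [div_mul_eq_mul_div, le_div_iff₀ (by positivity)]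
    refine le_of_mul_le_mul_right ?_ h0
    calc δ * (c * a) * δ = c * a * δ ^ 2 := by ring
      _ ≤ c * a * (L * ‖z (Fin.last N) - z 0‖ * ‖z (Fin.last N) - xb‖) ^ 2 := by gcongr
      _ = L ^ 2 * (c * ‖z (Fin.last N) - z 0‖ ^ 2) * (a * ‖z (Fin.last N) - xb‖ ^ 2) := by ring
      _ ≤ L ^ 2 * D * δ := by gcongr

/-- Convergence of cyclic coordinatewise minimization. -/
theorem tendsto_of_sweeps {Z : ℕ → Fin (N + 1) → J → ℝ} (hZ : ∀ r, M.IsSweep e (Z r))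
    (hnext : ∀ r, Z (r + 1) 0 = Z r (Fin.last N)) :
    ∃ x ∈ M.dom, (∀ w ∈ M.dom, M.obj x ≤ M.obj w) ∧
      Filter.Tendsto (fun r => Z r 0) Filter.atTop (nhds x) := by
  have hdom : ∀ r, Z r 0 ∈ M.dom := fun r => (hZ r).1
  obtain ⟨xs, hxs, -, hmin⟩ := M.exists_argmin_on_closed isClosed_univ (hdom 0) trivial
  replace hmin : ∀ w ∈ M.dom, M.obj xs ≤ M.obj w := fun w hw => hmin w hw trivial
  set m := M.obj (Z 0 0) with hm
  have hstep : ∀ r, M.obj (Z (r + 1) 0) ≤ M.obj (Z r 0) := fun r => by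
    rw [hnext]
    exact (hZ r).antitone_obj (Fin.zero_le _)
  have hanti : Antitone fun r => M.obj (Z r 0) := antitone_nat_of_succ_le hstep
  have hlevel : ∀ r, M.obj (Z r 0) ≤ m := fun r => hanti (Nat.zero_le r)
  obtain ⟨c, hc, hdec⟩ := M.exists_sufficient_decrease
  obtain ⟨C, hC, hlin⟩ := exists_linear_decrease hxs hmin m
  set δ : ℕ → ℝ := fun r => M.obj (Z r 0) - M.obj xs with hδ
  have hδ0 : ∀ r, 0 ≤ δ r := fun r => sub_nonneg.2 (hmin _ (hdom r))
  -- This solves `δ (r + 1) ≤ C * (δ r - δ (r + 1))` for `δ (r + 1)`.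
  set ρ : ℝ := C / (1 + C) with hρ
  have hρ0 : 0 ≤ ρ := by positivity
  have hρ1 : ρ < 1 := by rw [hρ, div_lt_one (by positivity)]; linarith
  have hgeo : ∀ r, δ r ≤ δ 0 * ρ ^ r := by
    intro r
    induction r with
    | zero => simp
    | succ r ih =>
      have h1 := hlin (hZ r) (hlevel r)
      rw [← hnext] at h1
      have h2 : δ (r + 1) ≤ ρ * δ r := by
        rw [hρ, div_mul_eq_mul_div, le_div_iff₀ (by positivity)]
        simp only [hδ]
        linarith
      calc δ (r + 1) ≤ ρ * δ r := h2
        _ ≤ ρ * (δ 0 * ρ ^ r) := by gcongr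
        _ = δ 0 * ρ ^ (r + 1) := by ring
  have hdist : ∀ r, dist (Z r 0) (Z (r + 1) 0) ≤ √(δ 0 / c) * √ρ ^ r := by
    intro r
    have h1 := hdec (hZ r)
    rw [← hnext] at h1
    rw [dist_comm, dist_eq_norm]
    refine abs_le_of_sq_le_sq' ?_ (by positivity) |>.2
    rw [mul_pow, ← pow_mul, mul_comm r 2, pow_mul, Real.sq_sqrt hρ0,
      Real.sq_sqrt (div_nonneg (hδ0 0) hc.le), div_mul_eq_mul_div, le_div_iff₀ hc]
    have h2 := hgeo r
    have h3 := hδ0 (r + 1)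
    simp only [hδ] at h2 h3 ⊢
    linarith
  have hsρ : √ρ < 1 := by rw [Real.sqrt_lt' one_pos]; simpa using hρ1
  obtain ⟨x, hx⟩ := cauchySeq_tendsto_of_complete (cauchySeq_of_le_geometric _ _ hsρ hdist)
  obtain ⟨hxd, -⟩ : x ∈ {x | x ∈ M.dom ∧ M.obj x ≤ m} :=
    (M.isCompact_sublevel m).isClosed.mem_of_tendsto hx
      (Filter.Eventually.of_forall fun r => ⟨hdom r, hlevel r⟩)
  refine ⟨x, hxd, ?_, hx⟩
  have hobj : Filter.Tendsto (fun r => M.obj (Z r 0)) Filter.atTop (nhds (M.obj x)) :=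
    (M.continuousOn_obj x hxd).tendsto.comp
      (tendsto_nhdsWithin_iff.2 ⟨hx, Filter.Eventually.of_forall hdom⟩)
  have hlim : Filter.Tendsto (fun r => M.obj xs + δ 0 * ρ ^ r) Filter.atTop (nhds (M.obj xs)) := by
    simpa using ((tendsto_pow_atTop_nhds_zero_of_lt_one hρ0 hρ1).const_mul (δ 0)).const_add
      (M.obj xs)
  have hle : M.obj x ≤ M.obj xs := le_of_tendsto_of_tendsto' hobj hlim fun r => by
    have := hgeo r
    simp only [hδ] at this ⊢
    linarith
  exact fun w hw => hle.trans (hmin w hw)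

end Model

/-! ### Passage between symmetric matrices and free coordinates -/

section Coordinates

variable {p : ℕ}

/-- The free coordinate that determines the entry `(i, j)` of a symmetric matrix. -/
def coordOf (i j : Fin p) : Coord p := ⟨(min i j, max i j), min_le_max⟩

lemma coordOf_comm (i j : Fin p) : coordOf i j = coordOf j i :=
  Subtype.ext (Prod.ext (min_comm i j) (max_comm i j))

lemma coordOf_coord (c : Coord p) : coordOf c.1.1 c.1.2 = c :=
  Subtype.ext (Prod.ext (min_eq_left c.2) (max_eq_right c.2))

lemma coordOf_eq_iff {i j : Fin p} {c : Coord p} :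
    coordOf i j = c ↔ (i, j) = c.1 ∨ (j, i) = c.1 := by
  constructor
  · rintro rfl
    rcases le_total i j with h | h
    · left; simp [coordOf, h]
    · right; simp [coordOf, h]
  · rintro (h | h)
    · have := coordOf_coord c
      rwa [← h] at this
    · have := coordOf_coord c
      rw [← h] at this
      rwa [coordOf_comm]

/-- The symmetric matrix with the given free coordinates. -/
def symMat : (Coord p → ℝ) →ₗ[ℝ] Matrix (Fin p) (Fin p) ℝ where
  toFun x := Matrix.of fun i j => x (coordOf i j)
  map_add' _ _ := rfl
  map_smul' _ _ := rfl

/-- The free coordinates of a matrix. -/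
def coords (Ω : Matrix (Fin p) (Fin p) ℝ) : Coord p → ℝ := fun c => Ω c.1.1 c.1.2

lemma symMat_apply (x : Coord p → ℝ) (i j : Fin p) : symMat x i j = x (coordOf i j) := rfl

lemma isSymm_symMat (x : Coord p → ℝ) : (symMat x).IsSymm :=
  Matrix.IsSymm.ext fun i j => by rw [symMat_apply, symMat_apply, coordOf_comm]

lemma symMat_coords {Ω : Matrix (Fin p) (Fin p) ℝ} (h : Ω.IsSymm) : symMat (coords Ω) = Ω := by
  ext i j
  rw [symMat_apply, coords]
  rcases le_total i j with hij | hij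
  · simp [coordOf, hij]
  · simpa [coordOf, hij] using h.apply i j

lemma continuous_symMat : Continuous (symMat : (Coord p → ℝ) → Matrix (Fin p) (Fin p) ℝ) :=
  LinearMap.continuous_of_finiteDimensional _

/-- The bilinear form whose associated quadratic form sums `Ω_{·i}ᵀ S Ω_{·i}` over the columns. -/
def columnForm (S : Matrix (Fin p) (Fin p) ℝ) : LinearMap.BilinForm ℝ (Coord p → ℝ) :=
  LinearMap.mk₂ ℝ (fun x y => ∑ i, (symMat x).col i ⬝ᵥ (S *ᵥ (symMat y).col i))
    (fun x y z => by
      rw [← Finset.sum_add_distrib]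
      refine Finset.sum_congr rfl fun i _ => ?_
      rw [← add_dotProduct, map_add]
      rfl)
    (fun t x y => by
      rw [smul_eq_mul, Finset.mul_sum]
      refine Finset.sum_congr rfl fun i _ => ?_
      rw [← smul_eq_mul, ← smul_dotProduct, map_smul]
      rfl)
    (fun x y z => by
      rw [← Finset.sum_add_distrib]
      refine Finset.sum_congr rfl fun i _ => ?_
      rw [← dotProduct_add, ← Matrix.mulVec_add, map_add]
      rfl)
    (fun t x y => by
      rw [smul_eq_mul, Finset.mul_sum]
      refine Finset.sum_congr rfl fun i _ => ?_
      rw [← smul_eq_mul, ← dotProduct_smul, ← Matrix.mulVec_smul, map_smul]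
      rfl)

lemma columnForm_apply (S : Matrix (Fin p) (Fin p) ℝ) (x y : Coord p → ℝ) :
    columnForm S x y = ∑ i, (symMat x).col i ⬝ᵥ (S *ᵥ (symMat y).col i) := rfl

variable {S : Matrix (Fin p) (Fin p) ℝ}

lemma dotProduct_mulVec_self_nonneg (hS : S.PosSemidef) (v : Fin p → ℝ) : 0 ≤ v ⬝ᵥ (S *ᵥ v) := by
  simpa using hS.dotProduct_mulVec_nonneg v

lemma columnForm_nonneg (hS : S.PosSemidef) (x : Coord p → ℝ) : 0 ≤ columnForm S x x := by
  rw [columnForm_apply]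
  exact Finset.sum_nonneg fun _ _ => dotProduct_mulVec_self_nonneg hS _

lemma columnForm_symm (hS : S.PosSemidef) (x y : Coord p → ℝ) :
    columnForm S x y = columnForm S y x := by
  have hT : Sᵀ = S := by simpa using hS.isHermitian.eq
  rw [columnForm_apply, columnForm_apply]
  refine Finset.sum_congr rfl fun i _ => ?_
  rw [Matrix.dotProduct_mulVec, dotProduct_comm, ← Matrix.mulVec_transpose, hT]

/-- Column `l` has its only nonzero entry in row `k`, so it contributes `S k k` times a nonzero
square. This covers both single coordinates and diagonal matrices. -/
lemma columnForm_pos (hS : S.PosSemidef) (hdiag : ∀ i, 0 < S i i) {x : Coord p → ℝ} {k l : Fin p}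
    (hk : x (coordOf k l) ≠ 0) (hx : ∀ i, i ≠ k → x (coordOf i l) = 0) : 0 < columnForm S x x := by
  rw [columnForm_apply]
  refine Finset.sum_pos' (fun _ _ => dotProduct_mulVec_self_nonneg hS _)
    ⟨l, Finset.mem_univ _, ?_⟩
  have hcol : (symMat x).col l = Pi.single k (x (coordOf k l)) := by
    ext i
    by_cases hi : i = k
    · subst hi; simp [symMat_apply]
    · simp [symMat_apply, hi, hx i hi]
  rw [hcol, single_dotProduct, Matrix.mulVec_single]
  have : x (coordOf k l) * (S k k * x (coordOf k l)) = S k k * x (coordOf k l) ^ 2 := by ring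
  simp only [Pi.smul_apply, Matrix.col_apply, MulOpposite.smul_eq_mul_unop, MulOpposite.unop_op]
  rw [this]
  have := hdiag k
  positivity

/-- The objective `Q_con` in free coordinates. -/
def model (hS : S.PosSemidef) (hdiag : ∀ i, 0 < S i i) {lam : ℝ} (hlam : 0 < lam) :
    Model (Coord p) where
  form := columnForm S
  barrier := Finset.univ.filter fun c => c.1.1 = c.1.2
  weight := lam
  symm := columnForm_symm hS
  nonneg := columnForm_nonneg hS
  diag_pos c := by
    refine columnForm_pos hS hdiag (k := c.1.1) (l := c.1.2) (by simp [coordOf_coord])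
      fun i hi => Pi.single_eq_of_ne (fun h => ?_) _
    rcases coordOf_eq_iff.1 h with h | h
    · exact hi (congrArg Prod.fst h)
    · exact hi ((congrArg Prod.snd h).trans (congrArg Prod.fst h))
  barrier_pos x hne hx := by
    obtain ⟨c, hc⟩ := Function.ne_iff.1 hne
    have hcd : c.1.1 = c.1.2 := by
      by_contra h
      exact hc (hx c (by simpa using h))
    refine columnForm_pos hS hdiag (k := c.1.1) (l := c.1.2) (by rwa [coordOf_coord])
      fun i hi => hx _ fun h => hi ?_
    have h2 : min i c.1.2 = max i c.1.2 := by simpa [coordOf] using h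
    rw [hcd]
    exact inf_eq_sup.1 h2
  weight_pos := hlam

lemma sum_coord_eq (F : Fin p → Fin p → ℝ) :
    ∑ c : Coord p, F c.1.1 c.1.2 = ∑ i, F i i + ∑ i, ∑ j ∈ Finset.Ioi i, F i j := by
  rw [← Finset.sum_subtype (Finset.univ.filter fun q : Fin p × Fin p => q.1 ≤ q.2)
    (by simp) (fun q => F q.1 q.2), Finset.sum_filter, Fintype.sum_prod_type,
    ← Finset.sum_add_distrib]
  refine Finset.sum_congr rfl fun i _ => ?_
  rw [← Finset.sum_filter, Finset.filter_le_eq_Ici, ← Finset.Ioi_insert,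
    Finset.sum_insert (by simp)]

variable (hS : S.PosSemidef) (hdiag : ∀ i, 0 < S i i) {lam : ℝ} (hlam : 0 < lam)

lemma mem_dom_model_iff {x : Coord p → ℝ} :
    x ∈ (model hS hdiag hlam).dom ↔ ∀ i, 0 < symMat x i i := by
  constructor
  · intro h i
    have := h (coordOf i i)
    simpa [Model.ray, model, coordOf, symMat_apply] using this
  · intro h c
    by_cases hc : c.1.1 = c.1.2
    · have h1 := h c.1.1
      rw [symMat_apply] at h1
      nth_rw 2 [hc] at h1
      rw [coordOf_coord] at h1
      simpa [Model.ray, model, hc] using h1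
    · simp [Model.ray, model, hc]

lemma obj_model (x : Coord p → ℝ) :
    (model hS hdiag hlam).obj x = ∑ i, -Real.log (symMat x i i) + quadL1 S lam (symMat x) := by
  have h := sum_coord_eq fun i j =>
    if i = j then -Real.log (symMat x i j) else lam * |symMat x i j|
  have h1 : ∀ i : Fin p, ∑ j ∈ Finset.Ioi i,
      (if i = j then -Real.log (symMat x i j) else lam * |symMat x i j|) =
      lam * ∑ j ∈ Finset.Ioi i, |symMat x i j| := by
    intro i
    rw [Finset.mul_sum]
    exact Finset.sum_congr rfl fun j hj => if_neg (Finset.mem_Ioi.1 hj).ne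
  simp only [h1, if_true, ← Finset.mul_sum] at h
  have h2 : ∑ c, (model hS hdiag hlam).pen c (x c) = ∑ c : Coord p,
      if c.1.1 = c.1.2 then -Real.log (symMat x c.1.1 c.1.2)
      else lam * |symMat x c.1.1 c.1.2| := by
    refine Finset.sum_congr rfl fun c _ => ?_
    rw [symMat_apply, coordOf_coord]
    simp [Model.pen, model]
  rw [Model.obj, h2, h, quadL1]
  simp only [model, columnForm_apply]
  ring

lemma negLog_ne_bot (t : ℝ) : negLog t ≠ ⊥ := by
  unfold negLog
  split_ifs <;> simp

lemma Qcon_symMat_of_mem {x : Coord p → ℝ} (hx : x ∈ (model hS hdiag hlam).dom) :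
    Qcon S lam (symMat x) = ((model hS hdiag hlam).obj x : EReal) := by
  rw [mem_dom_model_iff] at hx
  have h : ∑ i, negLog (symMat x i i) = ((∑ i, -Real.log (symMat x i i) : ℝ) : EReal) := by
    have hcoe : ∀ s : Finset (Fin p), ∑ i ∈ s, negLog (symMat x i i) =
        ((∑ i ∈ s, -Real.log (symMat x i i) : ℝ) : EReal) := by
      intro s
      induction s using Finset.induction_on with
      | empty => simp
      | insert a s ha ih =>
        rw [Finset.sum_insert ha, Finset.sum_insert ha, ih, EReal.coe_add, negLog, if_pos (hx a)]
    exact hcoe _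
  rw [Qcon, h, obj_model, EReal.coe_add]

lemma Qcon_eq_top_of_not_pos {Ω : Matrix (Fin p) (Fin p) ℝ} {i : Fin p} (hi : ¬0 < Ω i i) :
    Qcon S lam Ω = ⊤ := by
  have hbot : ∀ s : Finset (Fin p), ∑ k ∈ s, negLog (Ω k k) ≠ ⊥ := by
    intro s
    induction s using Finset.induction_on with
    | empty => simp
    | insert a s ha ih =>
      rw [Finset.sum_insert ha]
      exact EReal.add_ne_bot_iff.2 ⟨negLog_ne_bot _, ih⟩
  have hi' : negLog (Ω i i) = ⊤ := if_neg hi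
  rw [Qcon, ← Finset.add_sum_erase _ _ (Finset.mem_univ i), hi', EReal.top_add_of_ne_bot (hbot _),
    EReal.top_add_of_ne_bot (EReal.coe_ne_bot _)]

lemma Qcon_symMat_of_notMem {x : Coord p → ℝ} (hx : x ∉ (model hS hdiag hlam).dom) :
    Qcon S lam (symMat x) = ⊤ := by
  rw [mem_dom_model_iff] at hx
  push Not at hx
  obtain ⟨i, hi⟩ := hx
  exact Qcon_eq_top_of_not_pos (not_lt.2 hi)

lemma symMat_mem_feasible {x : Coord p → ℝ} (hx : x ∈ (model hS hdiag hlam).dom) :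
    symMat x ∈ feasible p :=
  ⟨isSymm_symMat x, fun i => ((mem_dom_model_iff hS hdiag hlam).1 hx i).le⟩

lemma isMinOn_Qcon {x : Coord p → ℝ} {K : Set (Matrix (Fin p) (Fin p) ℝ)}
    (hK : K ⊆ feasible p) (hx : x ∈ (model hS hdiag hlam).dom)
    (hmin : ∀ w ∈ (model hS hdiag hlam).dom, symMat w ∈ K →
      (model hS hdiag hlam).obj x ≤ (model hS hdiag hlam).obj w) :
    IsMinOn (Qcon S lam) K (symMat x) := by
  intro Ω hΩ
  rw [Set.mem_ofPred_eq]
  obtain ⟨w, rfl⟩ : ∃ w, symMat w = Ω := ⟨_, symMat_coords (hK hΩ).1⟩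
  by_cases hw : w ∈ (model hS hdiag hlam).dom
  · rw [Qcon_symMat_of_mem hS hdiag hlam hx, Qcon_symMat_of_mem hS hdiag hlam hw]
    exact EReal.coe_le_coe_iff.2 (hmin w hw hΩ)
  · rw [Qcon_symMat_of_notMem hS hdiag hlam hw]
    exact le_top

lemma symMat_mem_coordSlice_iff {c : Coord p} {x w : Coord p → ℝ}
    (hw : w ∈ (model hS hdiag hlam).dom) :
    symMat w ∈ coordSlice c (symMat x) ↔ ∀ k, k ≠ c → w k = x k := by
  constructor
  · rintro ⟨-, h⟩ k hk
    have h1 := h k.1.1 k.1.2 (fun h => hk (Subtype.ext h)) fun h => hk ?_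
    · rwa [symMat_apply, symMat_apply, coordOf_coord] at h1
    · rw [← coordOf_coord k]
      exact coordOf_eq_iff.2 (Or.inr h)
  · refine fun h => ⟨symMat_mem_feasible hS hdiag hlam hw, fun i j h1 h2 => h _ fun hc => ?_⟩
    exact (coordOf_eq_iff.1 hc).elim h1 h2

/-- The starting point competes with a finite value, so a minimizer over the slice cannot have a
zero diagonal entry. -/
lemma isCoordMin_symMat_iff {c : Coord p} {x : Coord p → ℝ} (hx : x ∈ (model hS hdiag hlam).dom)
    {Ω : Matrix (Fin p) (Fin p) ℝ} :
    IsCoordMin S lam c (symMat x) Ω ↔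
      ∃ y, (model hS hdiag hlam).IsCoordArgmin c x y ∧ symMat y = Ω := by
  constructor
  · rintro ⟨hmem, hmin⟩
    obtain ⟨y, rfl⟩ : ∃ y, symMat y = Ω := ⟨_, symMat_coords hmem.1.1⟩
    have hle : ∀ w ∈ (model hS hdiag hlam).dom, (∀ k, k ≠ c → w k = x k) →
        Qcon S lam (symMat y) ≤ (model hS hdiag hlam).obj w := fun w hw hwx => by
      rw [← Qcon_symMat_of_mem hS hdiag hlam hw]
      exact hmin ((symMat_mem_coordSlice_iff hS hdiag hlam hw).2 hwx)
    have hy : y ∈ (model hS hdiag hlam).dom := by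
      by_contra hy
      have := hle x hx fun _ _ => rfl
      rw [Qcon_symMat_of_notMem hS hdiag hlam hy, top_le_iff] at this
      exact EReal.coe_ne_top _ this
    refine ⟨y, ⟨hy, (symMat_mem_coordSlice_iff hS hdiag hlam hy).1 hmem, fun w hw hwx => ?_⟩, rfl⟩
    have := hle w hw hwx
    rw [Qcon_symMat_of_mem hS hdiag hlam hy] at this
    exact EReal.coe_le_coe_iff.1 this
  · rintro ⟨y, ⟨hy, hyx, hmin⟩, rfl⟩
    refine ⟨(symMat_mem_coordSlice_iff hS hdiag hlam hy).2 hyx,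
      isMinOn_Qcon hS hdiag hlam (fun _ h => h.1) hy fun w hw hwK => hmin w hw ?_⟩
    exact (symMat_mem_coordSlice_iff hS hdiag hlam hw).1 hwK

end Coordinates

/-! ### Existence and uniqueness of the run -/

section Run

variable {p N : ℕ} {S : Matrix (Fin p) (Fin p) ℝ} (hS : S.PosSemidef) (hdiag : ∀ i, 0 < S i i)
  {lam : ℝ} (hlam : 0 < lam) {e : Fin N ≃ Coord p} {x₀ : Coord p → ℝ}

lemma exists_model_run (hx₀ : x₀ ∈ (model hS hdiag hlam).dom) :
    ∃ z : ℕ → Fin (N + 1) → Coord p → ℝ, z 0 0 = x₀ ∧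
      (∀ r, (model hS hdiag hlam).IsSweep e (z r)) ∧ ∀ r, z (r + 1) 0 = z r (Fin.last N) := by
  choose T hT using fun (c : Coord p) (x : (model hS hdiag hlam).dom) =>
    (model hS hdiag hlam).exists_isCoordArgmin c x.2
  -- Recursion on the subtype carries domain membership along, which the next update needs.
  let sweep (x : (model hS hdiag hlam).dom) : Fin (N + 1) → (model hS hdiag hlam).dom :=
    Fin.induction x fun i y => ⟨T (e i) y, (hT (e i) y).1⟩
  let start : ℕ → (model hS hdiag hlam).dom :=
    Nat.rec ⟨x₀, hx₀⟩ fun _ x => sweep x (Fin.last N)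
  exact ⟨fun r i => sweep (start r) i, rfl,
    fun r => ⟨(sweep (start r) 0).2, fun i => hT (e i) (sweep (start r) i.castSucc)⟩, fun r => rfl⟩

lemma isCCMRun_of_sweeps {z : ℕ → Fin (N + 1) → Coord p → ℝ} (h0 : z 0 0 = x₀)
    (hz : ∀ r, (model hS hdiag hlam).IsSweep e (z r))
    (hnext : ∀ r, z (r + 1) 0 = z r (Fin.last N)) :
    IsCCMRun S lam e (symMat x₀) fun r i => symMat (z r i) where
  init := by rw [h0]
  step r i := (isCoordMin_symMat_iff hS hdiag hlam ((hz r).mem_dom _)).2 ⟨_, (hz r).2 i, rfl⟩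
  next r := by rw [hnext]

lemma IsCCMRun.eq_symMat {z : ℕ → Fin (N + 1) → Coord p → ℝ} (h0 : z 0 0 = x₀)
    (hz : ∀ r, (model hS hdiag hlam).IsSweep e (z r))
    (hnext : ∀ r, z (r + 1) 0 = z r (Fin.last N))
    {Z : ℕ → Fin (N + 1) → Matrix (Fin p) (Fin p) ℝ} (hZ : IsCCMRun S lam e (symMat x₀) Z) :
    Z = fun r i => symMat (z r i) := by
  have hsweep : ∀ r, Z r 0 = symMat (z r 0) → ∀ i, Z r i = symMat (z r i) := by
    intro r hr i
    induction i using Fin.induction with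
    | zero => exact hr
    | succ i ih =>
      have h := hZ.step r i
      rw [ih, isCoordMin_symMat_iff hS hdiag hlam ((hz r).mem_dom _)] at h
      obtain ⟨y, hy, hyZ⟩ := h
      rw [← hyZ, ((hz r).2 i).unique hy]
  have hstart : ∀ r, Z r 0 = symMat (z r 0) := by
    intro r
    induction r with
    | zero => rw [hZ.init, h0]
    | succ r ih => rw [hZ.next, hnext, hsweep r ih]
  exact funext fun r => funext fun i => hsweep r (hstart r) i

end Run

end Concord

theorem theorem5p1 {p N : ℕ}
    (S : Matrix (Fin p) (Fin p) ℝ) (hS : S.PosSemidef) (hdiag : ∀ i, 0 < S i i)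
    (lam : ℝ) (hlam : 0 < lam)
    (e : Fin N ≃ Concord.Coord p)
    (Ω₀ : Matrix (Fin p) (Fin p) ℝ) (hΩ₀ : Ω₀ ∈ Concord.feasible p)
    (hfin : Concord.Qcon S lam Ω₀ ≠ ⊤) :
    (∃! Z : ℕ → Fin (N + 1) → Matrix (Fin p) (Fin p) ℝ, Concord.IsCCMRun S lam e Ω₀ Z) ∧
    ∀ Z : ℕ → Fin (N + 1) → Matrix (Fin p) (Fin p) ℝ, Concord.IsCCMRun S lam e Ω₀ Z →
      ∃ Ωlim ∈ Concord.feasible p,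
        IsMinOn (Concord.Qcon S lam) (Concord.feasible p) Ωlim ∧
        Filter.Tendsto (fun r => Z r 0) Filter.atTop (nhds Ωlim) := by
  obtain ⟨x₀, rfl⟩ : ∃ x₀, Concord.symMat x₀ = Ω₀ := ⟨_, Concord.symMat_coords hΩ₀.1⟩
  have hx₀ : x₀ ∈ (Concord.model hS hdiag hlam).dom := by
    by_contra h
    exact hfin (Concord.Qcon_symMat_of_notMem hS hdiag hlam h)
  obtain ⟨z, h0, hz, hnext⟩ := Concord.exists_model_run (e := e) hS hdiag hlam hx₀
  have huniq : ∀ Z, Concord.IsCCMRun S lam e (Concord.symMat x₀) Z →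
      Z = fun r i => Concord.symMat (z r i) := fun Z hZ =>
    hZ.eq_symMat hS hdiag hlam h0 hz hnext
  refine ⟨⟨_, Concord.isCCMRun_of_sweeps hS hdiag hlam h0 hz hnext, huniq⟩, fun Z hZ => ?_⟩
  obtain ⟨x, hx, hmin, hlim⟩ := Concord.Model.tendsto_of_sweeps hz hnext
  refine ⟨Concord.symMat x, Concord.symMat_mem_feasible hS hdiag hlam hx,
    Concord.isMinOn_Qcon hS hdiag hlam subset_rfl hx fun w hw _ => hmin w hw, ?_⟩
  rw [huniq Z hZ]
  exact (Concord.continuous_symMat.tendsto x).comp hlim
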